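/- Let $d\ge 2$ be an integer, let $$f_d(x)=\prod_{t=0}^{\infty}\bigl(1-x^{-d^t}\bigr)\in\mathbb{Q}((x^{-1}))\quad\text{and}\quad g_d(x)=x^{-d+1}f_d(x).$$ Every $u\in\mathbb{Q}((x^{-1}))$ has a continued fraction expansion $u=[a_0;a_1,a_2,\ldots]$ with partial quotients $a_n\in\mathbb{Q}[x]$, obtained by taking polynomial parts in the continued fraction algorithm; its $n$-th convergent is the rational function $[a_0;a_1,\ldots,a_n]$, and $u$ is called badly approximable if the degrees of its partial quotients are bounded. Let $q_n\in\mathbb{Q}[x]$ denote the monic denominator of the $n$-th convergent of $g_d$ written in lowest terms. Assume that $f_d$ is badly approximable. Then $$q_1=x^{d-1}+\cdots+x+1,\qquad q_2=x^d+1,$$ and there are rational numbers $\beta_3,\beta_4,\beta_5,\ldots$ such that for all $k\ge 1$ $$q_{2k+1}=(x^{d-1}+\cdots+x+1)\,q_{2k}+\beta_{2k+1}\,q_{2k-1},$$ $$q_{2k+2}=(x-1)\,q_{2k+1}+\beta_{2k+2}\,q_{2k}.$$ -/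

import Mathlib

namespace GenThueMorse

/-! The field `ℚ((x⁻¹))` is realised as `LaurentSeries ℚ`, whose formal variable `X = single 1 1`
plays the role of `x⁻¹`. Thus the coefficient of `x ^ i` in `u` is `u.coeff (-i)`. -/

/-- The element `x` of `ℚ((x⁻¹))`. -/
noncomputable def x : LaurentSeries ℚ := HahnSeries.single (-1) 1

/-- The inclusion `ℚ[x] ⊆ ℚ((x⁻¹))`. -/
noncomputable def ofPoly : Polynomial ℚ →ₐ[ℚ] LaurentSeries ℚ := Polynomial.aeval x

/-- The polynomial part of a Laurent series: the sum of its terms of degree `≥ 0` in `x`.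
The degree of `u ≠ 0` in `x` is `-u.order`. -/
noncomputable def polyPart (u : LaurentSeries ℚ) : Polynomial ℚ :=
  ∑ i ∈ Finset.range ((-u.order).toNat + 1), Polynomial.monomial i (u.coeff (-(i : ℤ)))

/-- The complete quotients of the continued fraction algorithm: `u₀ = u` and
`uₙ₊₁ = 1 / (uₙ - polyPart uₙ)`. If the algorithm stops at `n`, that is `uₙ` is a polynomial,
all later values are `0`. -/
noncomputable def completeQuot (u : LaurentSeries ℚ) : ℕ → LaurentSeries ℚ
  | 0 => u
  | n + 1 => (completeQuot u n - ofPoly (polyPart (completeQuot u n)))⁻¹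

/-- The partial quotients `aₙ` of `u = [a₀; a₁, a₂, …]`. -/
noncomputable def partialQuot (u : LaurentSeries ℚ) (n : ℕ) : Polynomial ℚ :=
  polyPart (completeQuot u n)

/-- The finite continued fraction `[a₀; a₁, …, aₙ] = a₀ + 1 / [a₁; a₂, …, aₙ]`. -/
noncomputable def finiteCF (a : ℕ → Polynomial ℚ) : ℕ → RatFunc ℚ
  | 0 => algebraMap (Polynomial ℚ) (RatFunc ℚ) (a 0)
  | n + 1 => algebraMap (Polynomial ℚ) (RatFunc ℚ) (a 0) + (finiteCF (fun i => a (i + 1)) n)⁻¹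

/-- The `n`-th convergent of `u`. If the continued fraction of `u` stops, the sequence of
convergents is constant from there on. -/
noncomputable def convergent (u : LaurentSeries ℚ) (n : ℕ) : RatFunc ℚ :=
  finiteCF (partialQuot u) n

/-- The monic denominator of the `n`-th convergent of `u` in reduced form
(`RatFunc.denom` is the monic denominator of the reduced fraction). -/
noncomputable def convDenom (u : LaurentSeries ℚ) (n : ℕ) : Polynomial ℚ :=
  (convergent u n).denom

/-- A Laurent series is badly approximable if the degrees of its partial quotients are bounded. -/
def BadlyApproximable (u : LaurentSeries ℚ) : Prop :=
  ∃ C : ℕ, ∀ n : ℕ, (partialQuot u n).natDegree ≤ C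

open scoped PowerSeries.WithPiTopology in
/-- The infinite product `∏ₜ (1 - X ^ (d ^ t))` as a formal power series in `X = x⁻¹`
(coefficientwise convergence). -/
noncomputable def fPow (d : ℕ) : PowerSeries ℚ :=
  ∏' t : ℕ, (1 - (PowerSeries.X : PowerSeries ℚ) ^ (d ^ t))

open scoped PowerSeries.WithPiTopology in
/-- The infinite product defining `fPow` converges. -/
theorem multipliable_fPow (d : ℕ) (hd : 2 ≤ d) :
    Multipliable (fun t : ℕ => 1 - (PowerSeries.X : PowerSeries ℚ) ^ (d ^ t)) := by
  nontriviality ℚ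
  simp_rw [sub_eq_add_neg]
  apply PowerSeries.WithPiTopology.multipliable_one_add_of_tendsto_order_atTop_nhds_top
  refine ENat.tendsto_nhds_top_iff_natCast_lt.mpr fun n => Filter.eventually_atTop.mpr
    ⟨n, fun m hm => ?_⟩
  rw [PowerSeries.order_neg, PowerSeries.order_X_pow]
  exact_mod_cast lt_of_le_of_lt hm (Nat.lt_pow_self (by omega))

/-- The generalized Thue-Morse function `f_d(x) = ∏ₜ (1 - x ^ (-d ^ t))`. -/
noncomputable def f (d : ℕ) : LaurentSeries ℚ := HahnSeries.ofPowerSeries ℤ ℚ (fPow d)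

/-- `g_d(x) = x ^ (-d + 1) * f_d(x)`. -/
noncomputable def g (d : ℕ) : LaurentSeries ℚ := x ^ (-(d : ℤ) + 1) * f d

end GenThueMorse

namespace GenThueMorse
open Polynomial

/-! ### Polynomials inside Laurent series -/

/-! Put `G = x⁻¹ f_d`. The product gives `f_d(x) = (1 - x⁻¹) f_d(x ^ d)`, hence `g_d(x) = (x - 1)
G(x ^ d)` and `G = x ^ (d - 2) g_d` (`g_eq`, `shiftedF_eq_mul_g`). So an approximation `p/q` of `G`
yields `(x - 1) p(x ^ d) / q(x ^ d)` for `g_d`, and `x ^ (d - 2)` times it for `G` again. Call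
`ord(q G - p) - deg q` the excess of `p/q`. An excess of at least 2 would grow without bound under
this substitution, contradicting bad approximability of `f_d`. Hence every excess is at most 1 and
the partial quotients of `G` after the zeroth are linear (`order_error_shiftedF_le`,
`natDegree_cfDen_shiftedF`). The convergents of `G` therefore induce reduced convergents of `g_d`
with denominators of degree `d k`, each followed by one of degree `d k + d - 1`. No degree lies
strictly between that and `d (k + 1)`, so the induced convergents are exactly the even ones
(`natDegree_cfDen_g`). Thus even denominators are polynomials in `x ^ d` and even numerators vanish
at 1. The latter forces the monic multiplier `x - 1` in the even recurrence. Multiplying the odd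
recurrence by `x - 1` and eliminating odd denominators shows that `x - 1` times its multiplier is a
monic polynomial in `x ^ d` of degree `d` vanishing at 1, namely `x ^ d - 1`. -/

theorem x_pow (n : ℕ) : x ^ n = HahnSeries.single (-(n : ℤ)) (1 : ℚ) := by
  simp [x, HahnSeries.single_pow]

theorem x_ne_zero : x ≠ 0 := by
  simp [x]

theorem ofPoly_X : ofPoly X = x := by
  simp [ofPoly]

theorem ofPoly_monomial (n : ℕ) (r : ℚ) :
    ofPoly (monomial n r) = HahnSeries.single (-(n : ℤ)) r := by
  have h : algebraMap ℚ (LaurentSeries ℚ) = HahnSeries.C := Subsingleton.elim _ _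
  rw [ofPoly, aeval_monomial, x_pow, h, HahnSeries.C_apply, HahnSeries.single_mul_single]
  simp

theorem coeff_ofPoly_neg (p : ℚ[X]) (n : ℕ) : (ofPoly p).coeff (-(n : ℤ)) = p.coeff n := by
  induction p using Polynomial.induction_on' with
  | add p q hp hq => simp [hp, hq]
  | monomial m r =>
    rw [ofPoly_monomial, coeff_monomial, HahnSeries.coeff_single]
    by_cases h : m = n
    · simp [h]
    · rw [if_neg (by omega), if_neg h]

theorem ofPoly_injective : Function.Injective ofPoly := by
  intro p q h
  ext n
  rw [← coeff_ofPoly_neg, ← coeff_ofPoly_neg, h]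

theorem ofPoly_ne_zero {p : ℚ[X]} (hp : p ≠ 0) : ofPoly p ≠ 0 :=
  (map_ne_zero_iff _ ofPoly_injective).2 hp

theorem order_ofPoly (p : ℚ[X]) : (ofPoly p).order = -(p.natDegree : ℤ) := by
  rcases eq_or_ne p 0 with rfl | hp
  · simp
  apply le_antisymm
  · apply HahnSeries.order_le_of_coeff_ne_zero
    rw [coeff_ofPoly_neg]
    simpa using hp
  · rw [HahnSeries.le_order_iff_forall (ofPoly_ne_zero hp)]
    intro j hj
    obtain ⟨m, rfl⟩ : ∃ m : ℕ, j = -(m : ℤ) := ⟨j.natAbs, by omega⟩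
    rw [coeff_ofPoly_neg]
    exact coeff_eq_zero_of_natDegree_lt (by omega)

theorem order_mul_ofPoly {u : LaurentSeries ℚ} (hu : u ≠ 0) {p : ℚ[X]} (hp : p ≠ 0) :
    (ofPoly p * u).order = u.order - p.natDegree := by
  rw [HahnSeries.order_mul (ofPoly_ne_zero hp) hu, order_ofPoly]
  ring

theorem order_pos_of_eq_ofPoly {p : ℚ[X]} (h : 0 < (ofPoly p).order) : p = 0 := by
  rw [order_ofPoly] at h
  omega

theorem order_add_ge {u v : LaurentSeries ℚ} {m : ℤ} (huv : u + v ≠ 0)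
    (hu : m ≤ u.order) (hv : m ≤ v.order) : m ≤ (u + v).order :=
  (le_min hu hv).trans (HahnSeries.min_order_le_order_add huv)

theorem order_inv {u : LaurentSeries ℚ} (hu : u ≠ 0) : u⁻¹.order = -u.order := by
  have h := HahnSeries.order_mul hu (inv_ne_zero hu)
  rw [mul_inv_cancel₀ hu, HahnSeries.order_one] at h
  omega

/-! ### Polynomial parts -/

theorem coeff_polyPart (u : LaurentSeries ℚ) (n : ℕ) :
    (polyPart u).coeff n = u.coeff (-(n : ℤ)) := by
  rw [polyPart, finsetSum_coeff]
  simp only [coeff_monomial]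
  rw [Finset.sum_ite_eq' (Finset.range _)]
  split_ifs with h
  · rfl
  · rw [HahnSeries.coeff_eq_zero_of_lt_order]
    simp at h
    omega

theorem order_sub_polyPart {u : LaurentSeries ℚ} (hu : u - ofPoly (polyPart u) ≠ 0) :
    1 ≤ (u - ofPoly (polyPart u)).order := by
  rw [HahnSeries.le_order_iff_forall hu]
  intro j hj
  obtain ⟨m, rfl⟩ : ∃ m : ℕ, j = -(m : ℤ) := ⟨j.natAbs, by omega⟩
  rw [HahnSeries.coeff_sub, coeff_ofPoly_neg, coeff_polyPart, sub_self]

theorem natDegree_polyPart {u : LaurentSeries ℚ} (hu : u ≠ 0) (h : u.order ≤ 0) :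
    ((polyPart u).natDegree : ℤ) = -u.order := by
  obtain ⟨m, hm⟩ : ∃ m : ℕ, u.order = -(m : ℤ) := ⟨u.order.natAbs, by omega⟩
  rw [hm, neg_neg, Nat.cast_inj]
  apply natDegree_eq_of_le_of_coeff_ne_zero
  · rw [natDegree_le_iff_coeff_eq_zero]
    intro n hn
    rw [coeff_polyPart, HahnSeries.coeff_eq_zero_of_lt_order]
    omega
  · rw [coeff_polyPart, ← hm]
    simpa [HahnSeries.coeff_order_eq_zero] using hu

/-! ### Continuants -/

/-- Numerators of the finite continued fractions `[a₀; a₁, …, aₙ]`. -/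
noncomputable def cfNum : (ℕ → ℚ[X]) → ℕ → ℚ[X]
  | a, 0 => a 0
  | a, 1 => a 0 * a 1 + 1
  | a, n + 2 => a 0 * cfNum (fun i => a (i + 1)) (n + 1) + cfNum (fun i => a (i + 2)) n

/-- Denominators of the finite continued fractions `[a₀; a₁, …, aₙ]`. -/
noncomputable def cfDen (a : ℕ → ℚ[X]) : ℕ → ℚ[X]
  | 0 => 1
  | n + 1 => cfNum (fun i => a (i + 1)) n

theorem cfNum_succ (a : ℕ → ℚ[X]) (n : ℕ) :
    cfNum a (n + 1) = a 0 * cfNum (fun i => a (i + 1)) n + cfDen (fun i => a (i + 1)) n := by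
  cases n <;> simp [cfNum, cfDen, add_assoc]

/-- The definition peels off the first partial quotient, whereas the recurrence peels off the last.
The induction applies both to the sequence shifted by one and by two. -/
theorem cfNum_add_two (a : ℕ → ℚ[X]) (n : ℕ) :
    cfNum a (n + 2) = a (n + 2) * cfNum a (n + 1) + cfNum a n := by
  induction n using Nat.strong_induction_on generalizing a with
  | _ n ih =>
    match n with
    | 0 => simp [cfNum]; ring
    | 1 => simp [cfNum]; ring
    | n + 2 =>
      have h₁ := ih (n + 1) (by omega) fun i => a (i + 1)
      have h₂ := ih n (by omega) fun i => a (i + 2)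
      have e₁ : cfNum a (n + 4) = a 0 * cfNum (fun i => a (i + 1)) (n + 3) +
        cfNum (fun i => a (i + 2)) (n + 2) := by rw [cfNum]
      have e₂ : cfNum a (n + 3) = a 0 * cfNum (fun i => a (i + 1)) (n + 2) +
        cfNum (fun i => a (i + 2)) (n + 1) := by rw [cfNum]
      have e₃ : cfNum a (n + 2) = a 0 * cfNum (fun i => a (i + 1)) (n + 1) +
        cfNum (fun i => a (i + 2)) n := by rw [cfNum]
      simp only [add_assoc, Nat.reduceAdd] at *
      linear_combination e₁ - a (n + 4) * e₂ - e₃ + a 0 * h₁ + h₂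

theorem cfDen_add_two (a : ℕ → ℚ[X]) (n : ℕ) :
    cfDen a (n + 2) = a (n + 2) * cfDen a (n + 1) + cfDen a n := by
  cases n with
  | zero => simp [cfDen, cfNum]; ring
  | succ n => simp only [cfDen]; rw [cfNum_add_two]

theorem cfNum_mul_cfDen_sub (a : ℕ → ℚ[X]) (n : ℕ) :
    cfNum a (n + 1) * cfDen a n - cfNum a n * cfDen a (n + 1) = (-1) ^ n := by
  induction n with
  | zero => simp [cfNum, cfDen]
  | succ n ih =>
    rw [cfNum_add_two, cfDen_add_two, pow_succ, ← ih]
    ring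

theorem isCoprime_cfNum_cfDen (a : ℕ → ℚ[X]) (n : ℕ) : IsCoprime (cfNum a n) (cfDen a n) := by
  refine ⟨-(-1) ^ n * cfDen a (n + 1), (-1) ^ n * cfNum a (n + 1), ?_⟩
  have h := cfNum_mul_cfDen_sub a n
  have h2 : ((-1 : ℚ[X]) ^ n) * (-1) ^ n = 1 := by rw [← mul_pow]; simp
  linear_combination (-1) ^ n * h + h2

section Positive

variable {a : ℕ → ℚ[X]} (ha : ∀ n, 1 ≤ (a (n + 1)).natDegree)
include ha

theorem natDegree_cfDen_succ (n : ℕ) :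
    (cfDen a (n + 1)).natDegree = (a (n + 1)).natDegree + (cfDen a n).natDegree ∧
      cfDen a n ≠ 0 := by
  induction n with
  | zero => simp [cfDen, cfNum]
  | succ n ih =>
    have h0 : cfDen a (n + 1) ≠ 0 := by
      rintro h
      have := ha n
      rw [h, natDegree_zero] at ih
      omega
    have h1 : a (n + 2) ≠ 0 := by
      rintro h
      have := ha (n + 1)
      simp [h] at this
    refine ⟨?_, h0⟩
    have h2 := ha n
    have h3 := ha (n + 1)
    rw [cfDen_add_two, natDegree_add_eq_left_of_natDegree_lt, natDegree_mul h1 h0]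
    rw [natDegree_mul h1 h0]
    omega

theorem cfDen_ne_zero (n : ℕ) : cfDen a n ≠ 0 := (natDegree_cfDen_succ ha n).2

theorem strictMono_natDegree_cfDen : StrictMono fun n => (cfDen a n).natDegree :=
  strictMono_nat_of_lt_succ fun n => by
    have := ha n
    have := (natDegree_cfDen_succ ha n).1
    omega

theorem finiteCF_eq (n : ℕ) :
    finiteCF a n = algebraMap ℚ[X] (RatFunc ℚ) (cfNum a n) / algebraMap _ _ (cfDen a n) := by
  induction n generalizing a with
  | zero => simp [finiteCF, cfNum, cfDen]
  | succ n ih =>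
    have h : cfNum (fun i => a (i + 1)) n ≠ 0 := cfDen_ne_zero ha (n + 1)
    have h' : algebraMap ℚ[X] (RatFunc ℚ) (cfNum (fun i => a (i + 1)) n) ≠ 0 := by
      simpa using h
    rw [finiteCF, ih (fun n => ha (n + 1)), cfNum_succ, cfDen, map_add, map_mul]
    field_simp

end Positive

theorem denom_div_of_isCoprime {p q : ℚ[X]} (hq : q ≠ 0) (h : IsCoprime p q) :
    (algebraMap ℚ[X] (RatFunc ℚ) p / algebraMap _ _ q).denom = C q.leadingCoeff⁻¹ * q := by
  set r := algebraMap ℚ[X] (RatFunc ℚ) p / algebraMap _ _ q with hr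
  have h1 : r.denom ∣ q := RatFunc.denom_div_dvd p q
  have h2 : r.num * q = p * r.denom := (RatFunc.num_mul_eq_mul_denom_iff hq).2 hr
  have h3 : q ∣ r.denom := h.symm.dvd_of_dvd_mul_left ⟨r.num, by rw [← h2]; ring⟩
  have h4 : q * C q.leadingCoeff⁻¹ ∣ r.denom :=
    (IsUnit.mul_right_dvd (isUnit_C.2 (by simpa using hq))).2 h3
  have h5 : r.denom ∣ q * C q.leadingCoeff⁻¹ := h1.mul_right _
  rw [mul_comm]
  exact eq_of_monic_of_associated (RatFunc.monic_denom r) (monic_mul_leadingCoeff_inv hq)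
    (associated_of_dvd_dvd h5 h4)

/-! ### Continued fractions of irrational series -/

/-- A Laurent series is irrational if it is not a quotient of two polynomials. -/
def IsIrrational (u : LaurentSeries ℚ) : Prop :=
  ∀ p q : ℚ[X], q ≠ 0 → ofPoly q * u - ofPoly p ≠ 0

theorem IsIrrational.sub_polyPart_ne_zero {u : LaurentSeries ℚ} (hu : IsIrrational u) :
    u - ofPoly (polyPart u) ≠ 0 := by
  simpa using hu (polyPart u) 1 one_ne_zero

theorem IsIrrational.ne_zero {u : LaurentSeries ℚ} (hu : IsIrrational u) : u ≠ 0 := by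
  simpa using hu 0 1 one_ne_zero

/-- If `uₙ₊₁ = p/q` then `uₙ = aₙ + q/p`. Irrationality passes along the algorithm, so it never
stops. -/
theorem IsIrrational.completeQuot {u : LaurentSeries ℚ} (hu : IsIrrational u) (n : ℕ) :
    IsIrrational (completeQuot u n) := by
  induction n with
  | zero => exact hu
  | succ n ih =>
    intro p q hq h
    have h0 := ih.sub_polyPart_ne_zero
    rw [GenThueMorse.completeQuot, sub_eq_zero, mul_inv_eq_iff_eq_mul₀ h0] at h
    have hp : p ≠ 0 := by
      rintro rfl
      rw [map_zero, zero_mul] at h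
      exact ofPoly_ne_zero hq h
    apply ih (q + p * polyPart (GenThueMorse.completeQuot u n)) p hp
    rw [map_add, map_mul, h]
    ring

section Irrational

variable {u : LaurentSeries ℚ} (hu : IsIrrational u)
include hu

theorem order_completeQuot_succ (n : ℕ) : (completeQuot u (n + 1)).order ≤ -1 := by
  have h0 := (hu.completeQuot n).sub_polyPart_ne_zero
  rw [completeQuot, order_inv h0]
  have := order_sub_polyPart h0
  omega

theorem natDegree_partialQuot_succ (n : ℕ) :
    ((partialQuot u (n + 1)).natDegree : ℤ) = -(completeQuot u (n + 1)).order :=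
  natDegree_polyPart (hu.completeQuot _).ne_zero
    ((order_completeQuot_succ hu n).trans (by norm_num))

theorem one_le_natDegree_partialQuot (n : ℕ) : 1 ≤ (partialQuot u (n + 1)).natDegree := by
  have := natDegree_partialQuot_succ hu n
  have := order_completeQuot_succ hu n
  omega

theorem cfDen_partialQuot_ne_zero (n : ℕ) : cfDen (partialQuot u) n ≠ 0 :=
  cfDen_ne_zero (one_le_natDegree_partialQuot hu) n

/-- Successive errors `Qₙ u - Pₙ` have ratio `-1/uₙ₊₂`; taking orders turns this into the exact
error in `order_error`. -/
theorem completeQuot_mul_error (n : ℕ) :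
    completeQuot u (n + 2) *
      (ofPoly (cfDen (partialQuot u) (n + 1)) * u - ofPoly (cfNum (partialQuot u) (n + 1))) =
      -(ofPoly (cfDen (partialQuot u) n) * u - ofPoly (cfNum (partialQuot u) n)) := by
  have key : ∀ n, completeQuot u (n + 1) * (completeQuot u n - ofPoly (partialQuot u n)) = 1 :=
    fun n => inv_mul_cancel₀ (hu.completeQuot n).sub_polyPart_ne_zero
  induction n with
  | zero =>
    have h₀ := key 0
    have h₁ := key 1
    have e : completeQuot u 0 = u := rfl
    simp only [cfDen, cfNum, map_add, map_mul, map_one, one_mul, zero_add, e] at *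
    linear_combination completeQuot u 2 * h₀ + (ofPoly (partialQuot u 0) - u) * h₁
  | succ n ih =>
    have h₁ := key (n + 2)
    rw [cfDen_add_two, cfNum_add_two, map_add, map_mul, map_add, map_mul]
    linear_combination completeQuot u (n + 3) * ih -
      (ofPoly (cfDen (partialQuot u) (n + 1)) * u - ofPoly (cfNum (partialQuot u) (n + 1))) * h₁

theorem order_error (n : ℕ) :
    (ofPoly (cfDen (partialQuot u) n) * u - ofPoly (cfNum (partialQuot u) n)).order =
      (cfDen (partialQuot u) (n + 1)).natDegree := by
  induction n with
  | zero =>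
    have h := natDegree_partialQuot_succ hu 0
    rw [completeQuot, order_inv (hu.completeQuot 0).sub_polyPart_ne_zero, neg_neg] at h
    simp only [cfDen, cfNum, map_one, one_mul, zero_add] at *
    exact h.symm
  | succ n ih =>
    have h := congrArg HahnSeries.order (completeQuot_mul_error hu n)
    rw [HahnSeries.order_neg, ih, HahnSeries.order_mul (hu.completeQuot _).ne_zero
      (hu _ _ (cfDen_partialQuot_ne_zero hu _))] at h
    have h₁ := natDegree_partialQuot_succ hu (n + 1)
    have h₂ := (natDegree_cfDen_succ (one_le_natDegree_partialQuot hu) (n + 1)).1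
    push_cast [h₂]
    linarith

/-- A rational function approximating `u` better than the square of its denominator is a
convergent. -/
theorem exists_convergent_of_lt_order {p q : ℚ[X]} (hq : q ≠ 0)
    (h : (q.natDegree : ℤ) < (ofPoly q * u - ofPoly p).order) :
    ∃ n, p * cfDen (partialQuot u) n = cfNum (partialQuot u) n * q ∧
      (cfDen (partialQuot u) n).natDegree ≤ q.natDegree := by
  have mono := strictMono_natDegree_cfDen (one_le_natDegree_partialQuot hu)
  obtain ⟨n, hn, hn'⟩ : ∃ n, (cfDen (partialQuot u) n).natDegree ≤ q.natDegree ∧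
      q.natDegree < (cfDen (partialQuot u) (n + 1)).natDegree := by
    have h0 : ∃ n, q.natDegree < (cfDen (partialQuot u) n).natDegree :=
      ⟨q.natDegree + 1, mono.le_apply (x := q.natDegree + 1)⟩
    classical
    obtain ⟨n, hn⟩ : ∃ n, Nat.find h0 = n + 1 := by
      refine Nat.exists_eq_succ_of_ne_zero fun h => ?_
      have := Nat.find_spec h0
      rw [h] at this
      simp [cfDen] at this
    refine ⟨n, ?_, ?_⟩
    · exact not_lt.1 (Nat.find_min h0 (m := n) (by omega))
    · rw [← hn]; exact Nat.find_spec h0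
  refine ⟨n, ?_, hn⟩
  set P := cfNum (partialQuot u) n
  set Q := cfDen (partialQuot u) n
  have hQ : Q ≠ 0 := cfDen_partialQuot_ne_zero hu n
  by_contra hne
  -- If the fractions differ, this determinant is a nonzero polynomial, so its order is at most 0.
  -- The choice of `n` makes both terms on the right of positive order.
  have e : ofPoly (P * q - p * Q) =
      ofPoly Q * (ofPoly q * u - ofPoly p) + -(ofPoly q * (ofPoly Q * u - ofPoly P)) := by
    simp only [map_sub, map_mul]; ring
  have hd : P * q - p * Q ≠ 0 := fun h => hne (sub_eq_zero.1 h).symm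
  have : 1 ≤ (ofPoly (P * q - p * Q)).order := by
    have hd' := ofPoly_ne_zero hd
    rw [e] at hd' ⊢
    apply order_add_ge hd'
    · rw [order_mul_ofPoly (hu _ _ hq) hQ]
      omega
    · rw [HahnSeries.order_neg, order_mul_ofPoly (hu _ _ hQ) hq, order_error hu]
      omega
  exact hd (order_pos_of_eq_ofPoly (by omega))

/-- Both sides equal the order of `u` minus the common fraction, which does not depend on the
representation. -/
theorem order_error_of_mul_eq {p q P Q : ℚ[X]} (hq : q ≠ 0) (hQ : Q ≠ 0) (h : p * Q = P * q) :
    (ofPoly q * u - ofPoly p).order + q.natDegree =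
      (ofPoly Q * u - ofPoly P).order + Q.natDegree := by
  have e : ofPoly Q * (ofPoly q * u - ofPoly p) = ofPoly q * (ofPoly Q * u - ofPoly P) := by
    have := congrArg ofPoly h
    simp only [map_mul] at this
    linear_combination -this
  have := congrArg HahnSeries.order e
  rw [order_mul_ofPoly (hu _ _ hq) hQ, order_mul_ofPoly (hu _ _ hQ) hq] at this
  omega

/-- Badly approximable irrational series have no approximations much better than the square of
the denominator. -/
theorem BadlyApproximable.exists_order_le (hb : BadlyApproximable u) :
    ∃ c : ℕ, ∀ p q : ℚ[X], q ≠ 0 →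
      (ofPoly q * u - ofPoly p).order ≤ q.natDegree + c := by
  obtain ⟨c, hc⟩ := hb
  refine ⟨c, fun p q hq => ?_⟩
  by_cases h : (q.natDegree : ℤ) < (ofPoly q * u - ofPoly p).order
  · obtain ⟨n, hn, hle⟩ := exists_convergent_of_lt_order hu hq h
    have h₁ := order_error_of_mul_eq hu hq (cfDen_partialQuot_ne_zero hu n) hn
    have h₂ := (natDegree_cfDen_succ (one_le_natDegree_partialQuot hu) n).1
    have h₃ := hc (n + 1)
    rw [order_error hu] at h₁
    omega
  · omega

/-- A reduced fraction approximating `u` better than the square of its denominator is a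
convergent, and the quality of the approximation determines the next denominator degree. -/
theorem exists_convergent_of_isCoprime {p q : ℚ[X]} (hq : q ≠ 0) (hpq : IsCoprime p q)
    (h : (q.natDegree : ℤ) < (ofPoly q * u - ofPoly p).order) :
    ∃ (n : ℕ) (c : ℚ), c ≠ 0 ∧ cfNum (partialQuot u) n = C c * p ∧
      cfDen (partialQuot u) n = C c * q ∧
      ((cfDen (partialQuot u) (n + 1)).natDegree : ℤ) = (ofPoly q * u - ofPoly p).order := by
  obtain ⟨n, hn, -⟩ := exists_convergent_of_lt_order hu hq h
  have hQ := cfDen_partialQuot_ne_zero hu n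
  have h₁ : q ∣ cfDen (partialQuot u) n := hpq.symm.dvd_of_dvd_mul_left ⟨_, hn.trans (mul_comm _ _)⟩
  have h₂ : cfDen (partialQuot u) n ∣ q :=
    (isCoprime_cfNum_cfDen _ n).symm.dvd_of_dvd_mul_left ⟨p, by rw [← hn, mul_comm]⟩
  obtain ⟨w, hw⟩ := associated_of_dvd_dvd h₁ h₂
  obtain ⟨c, hc, hc'⟩ := isUnit_iff.1 w.isUnit
  have hden : cfDen (partialQuot u) n = C c * q := by rw [← hw, ← hc', mul_comm]
  have hc0 : c ≠ 0 := hc.ne_zero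
  refine ⟨n, c, hc0, ?_, hden, ?_⟩
  · rw [hden] at hn
    apply mul_right_cancel₀ hq
    rw [← hn]
    ring
  · have := order_error_of_mul_eq hu hq hQ hn
    rw [order_error hu, hden, natDegree_C_mul hc0] at this
    omega

theorem convDenom_eq (n : ℕ) :
    convDenom u n = C (cfDen (partialQuot u) n).leadingCoeff⁻¹ * cfDen (partialQuot u) n := by
  rw [convDenom, convergent, finiteCF_eq (one_le_natDegree_partialQuot hu),
    denom_div_of_isCoprime (cfDen_partialQuot_ne_zero hu n) (isCoprime_cfNum_cfDen _ n)]

end Irrational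

/-! ### The substitution `x ↦ x ^ d` -/

/-- The endomorphism `u(x) ↦ u(x ^ d)` of the field of Laurent series. -/
noncomputable def dilate (d : ℕ) (hd : 0 < d) : LaurentSeries ℚ →+* LaurentSeries ℚ :=
  HahnSeries.embDomainRingHom (AddMonoidHom.mulLeft (d : ℤ))
    (fun a b h => by
      have hd' : (d : ℤ) ≠ 0 := by positivity
      exact mul_left_cancel₀ hd' h)
    (fun a b => by
      have hd' : (0 : ℤ) < d := by positivity
      exact mul_le_mul_iff_right₀ hd')

section Dilate

variable {d : ℕ} (hd : 0 < d)

theorem coeff_dilate_mul (u : LaurentSeries ℚ) (i : ℤ) :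
    (dilate d hd u).coeff (d * i) = u.coeff i :=
  HahnSeries.embDomain_coeff (f := ⟨⟨_, _⟩, _⟩)

theorem coeff_dilate_of_not_dvd (u : LaurentSeries ℚ) {i : ℤ} (hi : ¬ (d : ℤ) ∣ i) :
    (dilate d hd u).coeff i = 0 := by
  apply HahnSeries.embDomain_of_notMem_range
  rintro ⟨j, rfl⟩
  exact hi ⟨j, rfl⟩

theorem dilate_single (i : ℤ) (r : ℚ) :
    dilate d hd (HahnSeries.single i r) = HahnSeries.single (d * i) r :=
  HahnSeries.embDomain_single

theorem dilate_ofPoly (p : ℚ[X]) : dilate d hd (ofPoly p) = ofPoly (expand ℚ d p) := by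
  induction p using Polynomial.induction_on' with
  | add p q hp hq => simp [hp, hq]
  | monomial m r =>
    rw [expand_monomial, ofPoly_monomial, ofPoly_monomial, dilate_single]
    rw [Nat.cast_mul, mul_neg, mul_comm]

theorem order_dilate {u : LaurentSeries ℚ} (hu : u ≠ 0) :
    (dilate d hd u).order = d * u.order := by
  have hu' : dilate d hd u ≠ 0 := (_root_.map_ne_zero _).2 hu
  apply le_antisymm
  · apply HahnSeries.order_le_of_coeff_ne_zero
    rw [coeff_dilate_mul]
    simpa [HahnSeries.coeff_order_eq_zero] using hu
  · rw [HahnSeries.le_order_iff_forall hu']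
    intro j hj
    by_cases h : (d : ℤ) ∣ j
    · obtain ⟨i, rfl⟩ := h
      rw [coeff_dilate_mul]
      apply HahnSeries.coeff_eq_zero_of_lt_order
      exact lt_of_mul_lt_mul_left hj (by positivity)
    · exact coeff_dilate_of_not_dvd hd u h

theorem dilate_ofPowerSeries (F : PowerSeries ℚ) :
    dilate d hd (HahnSeries.ofPowerSeries ℤ ℚ F) =
      HahnSeries.ofPowerSeries ℤ ℚ (F.expand d hd.ne') := by
  ext i
  by_cases h : (d : ℤ) ∣ i
  · obtain ⟨i, rfl⟩ := h
    rw [coeff_dilate_mul]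
    rcases le_or_gt 0 i with hi | hi
    · lift i to ℕ using hi
      have := HahnSeries.ofPowerSeries_apply_coeff (Γ := ℤ) (F.expand d hd.ne') (d * i)
      push_cast at this
      rw [this, PowerSeries.coeff_expand_mul]
      exact HahnSeries.ofPowerSeries_apply_coeff F i
    · have hi' : (d : ℤ) * i < 0 := mul_neg_of_pos_of_neg (by positivity) hi
      rw [PowerSeries.coeff_coe, if_pos hi, PowerSeries.coeff_coe, if_pos hi']
  · rw [coeff_dilate_of_not_dvd hd _ h]
    rcases le_or_gt 0 i with hi | hi
    · lift i to ℕ using hi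
      rw [PowerSeries.coeff_coe, if_neg (by omega)]
      rw [PowerSeries.coeff_expand_of_not_dvd]
      simpa [Int.natCast_dvd_natCast] using h
    · rw [PowerSeries.coeff_coe, if_pos hi]

end Dilate

/-! ### The functional equation -/

open scoped PowerSeries.WithPiTopology in
theorem continuous_expand (d : ℕ) (hd : d ≠ 0) :
    Continuous (PowerSeries.expand d hd : PowerSeries ℚ → PowerSeries ℚ) := by
  rw [continuous_iff_continuousAt]
  intro F
  rw [ContinuousAt, PowerSeries.WithPiTopology.tendsto_iff_coeff_tendsto]
  intro n
  simp only [PowerSeries.coeff_expand]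
  split_ifs with h
  · exact (PowerSeries.WithPiTopology.continuous_coeff ℚ (n / d)).continuousAt
  · exact tendsto_const_nhds

open scoped PowerSeries.WithPiTopology in
-- Substituting `X ^ d` for `X` shifts the index of the factors by one, so only the factor at `t =
-- 0` is left over. Continuity of `expand` lets it pass through the infinite product.
theorem fPow_eq (d : ℕ) (hd : 2 ≤ d) :
    fPow d = (1 - PowerSeries.X) * (fPow d).expand d (by omega) := by
  have hm := multipliable_fPow d hd
  have hd0 : d ≠ 0 := by omega
  have e : ∀ t : ℕ, (1 - (PowerSeries.X : PowerSeries ℚ) ^ (d ^ (t + 1))) =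
      PowerSeries.expand d hd0 (1 - PowerSeries.X ^ (d ^ t)) := by
    intro t
    rw [map_sub, map_one, map_pow, PowerSeries.expand_X, ← pow_mul, pow_succ']
  have hm' : Multipliable fun t : ℕ => (1 - (PowerSeries.X : PowerSeries ℚ) ^ (d ^ (t + 1))) := by
    simp only [e]
    exact hm.map (PowerSeries.expand d hd0) (continuous_expand d hd0)
  have h : fPow d = _ := tprod_eq_zero_mul' hm'
  have h' : PowerSeries.expand d hd0 (fPow d) = _ :=
    hm.map_tprod (PowerSeries.expand d hd0) (continuous_expand d hd0)
  rw [h', h, pow_zero, pow_one]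
  exact congrArg _ (tprod_congr e)

open scoped PowerSeries.WithPiTopology in
theorem constantCoeff_fPow (d : ℕ) (hd : 2 ≤ d) : (fPow d).constantCoeff = 1 := by
  rw [fPow, (multipliable_fPow d hd).map_tprod PowerSeries.constantCoeff
    (PowerSeries.WithPiTopology.continuous_constantCoeff ℚ)]
  have hd0 : d ≠ 0 := by omega
  simp [hd0]

theorem coeff_one_fPow (d : ℕ) (hd : 2 ≤ d) : (fPow d).coeff 1 = -1 := by
  have h : ¬ d ∣ 1 := by
    rw [Nat.dvd_one]
    omega
  rw [fPow_eq d hd, sub_mul, one_mul, map_sub, PowerSeries.coeff_expand_of_not_dvd _ _ _ h,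
    ← zero_add 1, PowerSeries.coeff_succ_X_mul]
  simp [constantCoeff_fPow d hd]

/-- The series `x⁻¹ f_d(x)`. -/
noncomputable def shiftedF (d : ℕ) : LaurentSeries ℚ := x⁻¹ * f d

theorem f_eq (d : ℕ) : f d = ofPoly X * shiftedF d := by
  rw [shiftedF, ofPoly_X, mul_inv_cancel_left₀ x_ne_zero]

theorem ofPowerSeries_X_eq : HahnSeries.ofPowerSeries ℤ ℚ PowerSeries.X = x⁻¹ := by
  rw [HahnSeries.ofPowerSeries_X, x, HahnSeries.inv_single]
  simp

theorem f_functional {d : ℕ} (hd : 2 ≤ d) :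
    f d = x⁻¹ * ofPoly (X - 1) * dilate d (by omega) (f d) := by
  conv_lhs => rw [f, fPow_eq d hd]
  rw [map_mul, ← dilate_ofPowerSeries (by omega), ← f, map_sub, map_one, ofPowerSeries_X_eq, map_sub, map_one,
    ofPoly_X, mul_sub, inv_mul_cancel₀ x_ne_zero, mul_one]

theorem g_eq {d : ℕ} (hd : 2 ≤ d) :
    g d = ofPoly (X - 1) * dilate d (by omega) (shiftedF d) := by
  rw [g, f_functional hd, f_eq, map_mul, dilate_ofPoly, expand_X, map_pow, ofPoly_X,
    zpow_add₀ x_ne_zero, zpow_neg, zpow_natCast, zpow_one]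
  have := x_ne_zero
  field_simp

theorem shiftedF_eq_mul_g {d : ℕ} (hd : 2 ≤ d) : shiftedF d = ofPoly (X ^ (d - 2)) * g d := by
  obtain ⟨e, rfl⟩ := Nat.exists_eq_add_of_le' hd
  rw [g, shiftedF, map_pow, ofPoly_X, ← mul_assoc, ← zpow_natCast, ← zpow_add₀ x_ne_zero,
    ← zpow_neg_one]
  congr 2
  push_cast [Nat.add_sub_cancel]
  ring

theorem f_ne_zero {d : ℕ} (hd : 2 ≤ d) : f d ≠ 0 := by
  rw [f, map_ne_zero_iff _ HahnSeries.ofPowerSeries_injective]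
  intro h
  simpa [h] using constantCoeff_fPow d hd

/-! ### Irrationality -/

/-- `x ^ d - 1` is `x - 1` times a geometric sum whose value at 1 is `d ≠ 0`, so the substitution
creates no further zeros at 1. -/
theorem rootMultiplicity_one_expand {d : ℕ} (hd : 0 < d) {p : ℚ[X]} (hp : p ≠ 0) :
    (expand ℚ d p).rootMultiplicity 1 = p.rootMultiplicity 1 := by
  obtain ⟨r, hr, hr'⟩ := exists_eq_pow_rootMultiplicity_mul_and_not_dvd p hp 1
  set m := p.rootMultiplicity 1
  have h1 : (expand ℚ d r).eval 1 ≠ 0 := by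
    rw [expand_eval, one_pow]
    rwa [dvd_iff_isRoot] at hr'
  have h2 : (∑ i ∈ Finset.range d, (X : ℚ[X]) ^ i).eval 1 ≠ 0 := by
    simp [eval_finsetSum, hd.ne']
  have e : expand ℚ d p =
      (X - C 1) ^ m * ((∑ i ∈ Finset.range d, (X : ℚ[X]) ^ i) ^ m * expand ℚ d r) := by
    conv_lhs => rw [hr]
    rw [map_mul, map_pow, map_sub, expand_X, expand_C, ← mul_assoc, ← mul_pow,
      map_one, mul_geom_sum]
  have h3 : ((∑ i ∈ Finset.range d, (X : ℚ[X]) ^ i) ^ m * expand ℚ d r).eval 1 ≠ 0 := by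
    rw [eval_mul, eval_pow]
    exact mul_ne_zero (pow_ne_zero _ h2) h1
  have h4 : (∑ i ∈ Finset.range d, (X : ℚ[X]) ^ i) ^ m * expand ℚ d r ≠ 0 := by
    intro h
    simp [h] at h3
  rw [e, rootMultiplicity_mul (mul_ne_zero (pow_ne_zero _ (X_sub_C_ne_zero 1)) h4),
    rootMultiplicity_X_sub_C_pow, rootMultiplicity_eq_zero h3, add_zero]

/-- If `G = p/q`, the functional equation becomes the polynomial identity `key`. The zero at 1 has
the same multiplicity on both sides except for the extra factor `x - 1`, which is impossible. -/
theorem isIrrational_shiftedF {d : ℕ} (hd : 2 ≤ d) : IsIrrational (shiftedF d) := by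
  intro p q hq h
  rw [sub_eq_zero] at h
  have hd0 : 0 < d := by omega
  have hG : shiftedF d ≠ 0 := mul_ne_zero (inv_ne_zero x_ne_zero) (f_ne_zero hd)
  have hp : p ≠ 0 := by
    rintro rfl
    rw [map_zero] at h
    exact mul_ne_zero (ofPoly_ne_zero hq) hG h
  have h' := congrArg (dilate d hd0) h
  rw [map_mul, dilate_ofPoly, dilate_ofPoly] at h'
  have hG' := shiftedF_eq_mul_g hd
  rw [g_eq hd] at hG'
  have key : expand ℚ d q * p = q * X ^ (d - 2) * ((X - C 1) * expand ℚ d p) := by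
    apply ofPoly_injective
    rw [map_one]
    simp only [map_mul]
    linear_combination (-ofPoly (expand ℚ d q)) * h +
      ofPoly q * ofPoly (X ^ (d - 2)) * ofPoly (X - 1) * h' +
      ofPoly (expand ℚ d q) * ofPoly q * hG'
  have hq' : expand ℚ d q ≠ 0 := by rwa [Ne, expand_eq_zero hd0]
  have hp' : expand ℚ d p ≠ 0 := by rwa [Ne, expand_eq_zero hd0]
  have hX : (X : ℚ[X]) ^ (d - 2) ≠ 0 := pow_ne_zero _ X_ne_zero
  have hX1 : rootMultiplicity 1 ((X : ℚ[X]) ^ (d - 2)) = 0 :=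
    rootMultiplicity_eq_zero (by simp)
  have := congrArg (rootMultiplicity 1) key
  have h1 : (X : ℚ[X]) - C 1 ≠ 0 := X_sub_C_ne_zero 1
  rw [rootMultiplicity_mul (mul_ne_zero hq' hp), rootMultiplicity_mul
    (mul_ne_zero (mul_ne_zero hq hX) (mul_ne_zero h1 hp')), rootMultiplicity_mul
    (mul_ne_zero hq hX), rootMultiplicity_mul (mul_ne_zero h1 hp'),
    rootMultiplicity_one_expand hd0 hp, rootMultiplicity_one_expand hd0 hq, hX1,
    rootMultiplicity_X_sub_C_self] at this
  omega

theorem isIrrational_f {d : ℕ} (hd : 2 ≤ d) : IsIrrational (f d) := by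
  intro p q hq
  rw [f_eq, ← mul_assoc, ← map_mul]
  exact isIrrational_shiftedF hd _ _ (mul_ne_zero hq X_ne_zero)

theorem isIrrational_g {d : ℕ} (hd : 2 ≤ d) : IsIrrational (g d) := by
  intro p q hq h
  apply isIrrational_shiftedF hd (X ^ (d - 2) * p) q hq
  rw [shiftedF_eq_mul_g hd, map_mul]
  linear_combination ofPoly (X ^ (d - 2)) * h

/-! ### Rational approximations of `x⁻¹ f_d(x)` and `g_d(x)` -/

section Approximation

variable {d : ℕ} (hd : 2 ≤ d)
include hd

theorem order_error_g_expand (p : ℚ[X]) {q : ℚ[X]} (hq : q ≠ 0) :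
    (ofPoly (expand ℚ d q) * g d - ofPoly ((X - 1) * expand ℚ d p)).order =
      d * (ofPoly q * shiftedF d - ofPoly p).order - 1 := by
  have hd0 : 0 < d := by omega
  have e : ofPoly (expand ℚ d q) * g d - ofPoly ((X - 1) * expand ℚ d p) =
      ofPoly (X - C 1) * dilate d hd0 (ofPoly q * shiftedF d - ofPoly p) := by
    rw [map_sub (dilate d hd0), map_mul, map_mul, dilate_ofPoly, dilate_ofPoly, g_eq hd, map_one]
    ring
  have h0 := isIrrational_shiftedF hd p q hq
  rw [e, order_mul_ofPoly ((_root_.map_ne_zero _).2 h0) (X_sub_C_ne_zero 1), order_dilate hd0 h0,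
    natDegree_X_sub_C, Nat.cast_one]

theorem order_error_shiftedF_expand (p : ℚ[X]) {q : ℚ[X]} (hq : q ≠ 0) :
    (ofPoly (expand ℚ d q) * shiftedF d -
      ofPoly (X ^ (d - 2) * ((X - 1) * expand ℚ d p))).order =
      d * (ofPoly q * shiftedF d - ofPoly p).order - (d - 1) := by
  have hq' : expand ℚ d q ≠ 0 := by rwa [Ne, expand_eq_zero (by omega)]
  have e : ofPoly (expand ℚ d q) * shiftedF d -
      ofPoly (X ^ (d - 2) * ((X - 1) * expand ℚ d p)) =
      ofPoly (X ^ (d - 2)) * (ofPoly (expand ℚ d q) * g d - ofPoly ((X - 1) * expand ℚ d p)) := by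
    rw [map_mul, shiftedF_eq_mul_g hd]
    ring
  rw [e, order_mul_ofPoly (isIrrational_g hd _ _ hq') (pow_ne_zero _ X_ne_zero),
    order_error_g_expand hd p hq, natDegree_X_pow]
  push_cast [Nat.cast_sub hd]
  ring

variable (hf : BadlyApproximable (f d))
include hf

/-- Substitution sends excess `e` to `d e - (d - 1)`: it fixes 1 and strictly increases anything
from 2 on. Iterating a bad approximation contradicts the bound for `f d`, since passing from `G` to
`f d = x G` costs only 1 in the order. -/
theorem order_error_shiftedF_le (p : ℚ[X]) {q : ℚ[X]} (hq : q ≠ 0) :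
    (ofPoly q * shiftedF d - ofPoly p).order ≤ q.natDegree + 1 := by
  obtain ⟨c, hc⟩ := BadlyApproximable.exists_order_le (isIrrational_f hd) hf
  by_contra! hlt
  have key : ∀ n : ℕ, ∃ p q : ℚ[X], q ≠ 0 ∧
      (q.natDegree : ℤ) + n + 2 ≤ (ofPoly q * shiftedF d - ofPoly p).order := by
    intro n
    induction n with
    | zero => exact ⟨p, q, hq, by push_cast; omega⟩
    | succ n ih =>
      obtain ⟨p, q, hq, h⟩ := ih
      refine ⟨X ^ (d - 2) * ((X - 1) * expand ℚ d p), expand ℚ d q,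
        by rwa [Ne, expand_eq_zero (by omega)], ?_⟩
      rw [order_error_shiftedF_expand hd p hq, natDegree_expand]
      push_cast
      have hd' : (2 : ℤ) ≤ d := by exact_mod_cast hd
      have hn : (0 : ℤ) ≤ n := by positivity
      nlinarith [mul_le_mul_of_nonneg_left h (show (0 : ℤ) ≤ d by omega),
        mul_nonneg hn (show (0 : ℤ) ≤ d - 2 by omega)]
  obtain ⟨p, q, hq, h⟩ := key c
  have h' := hc (X * p) q hq
  have e : ofPoly q * f d - ofPoly (X * p) =
      ofPoly X * (ofPoly q * shiftedF d - ofPoly p) := by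
    rw [f_eq, map_mul]
    ring
  rw [e, order_mul_ofPoly (isIrrational_shiftedF hd _ _ hq) X_ne_zero, natDegree_X] at h'
  omega

/-- If `q(1) = 0`, the factor `x - 1` cancels from the induced fraction for `G`. This lowers the
denominator degree by 1 and raises the order by 1, so the excess reaches at least 3. -/
theorem eval_one_ne_zero_of_lt_order {p q : ℚ[X]} (hq : q ≠ 0)
    (h : (q.natDegree : ℤ) < (ofPoly q * shiftedF d - ofPoly p).order) : q.eval 1 ≠ 0 := by
  intro h1
  have h2 : (expand ℚ d q).IsRoot 1 := by rw [IsRoot, expand_eval, one_pow, h1]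
  obtain ⟨r, hr⟩ := dvd_iff_isRoot.2 h2
  have hq' : expand ℚ d q ≠ 0 := by rwa [Ne, expand_eq_zero (by omega)]
  have hr0 : r ≠ 0 := by
    rintro rfl
    rw [mul_zero] at hr
    exact hq' hr
  have hdeg := congrArg natDegree hr
  rw [natDegree_expand, natDegree_mul (X_sub_C_ne_zero 1) hr0, natDegree_X_sub_C] at hdeg
  have e : ofPoly (expand ℚ d q) * shiftedF d -
      ofPoly (X ^ (d - 2) * ((X - 1) * expand ℚ d p)) =
      ofPoly (X - C 1) * (ofPoly r * shiftedF d - ofPoly (X ^ (d - 2) * expand ℚ d p)) := by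
    rw [hr, map_one]
    simp only [map_mul]
    ring
  have h3 := order_error_shiftedF_expand hd p hq
  rw [e, order_mul_ofPoly (isIrrational_shiftedF hd _ _ hr0) (X_sub_C_ne_zero 1),
    natDegree_X_sub_C] at h3
  have h4 := order_error_shiftedF_le hd hf (X ^ (d - 2) * expand ℚ d p) hr0
  zify at hdeg
  have h5 : (d : ℤ) * (q.natDegree + 1) ≤ d * (ofPoly q * shiftedF d - ofPoly p).order :=
    mul_le_mul_of_nonneg_left h (by positivity)
  push_cast at h3
  linarith

theorem natDegree_cfDen_shiftedF (k : ℕ) :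
    (cfDen (partialQuot (shiftedF d)) k).natDegree = k := by
  have hG := isIrrational_shiftedF hd
  induction k with
  | zero => simp [cfDen]
  | succ k ih =>
    have h₁ := order_error hG k
    have h₂ := order_error_shiftedF_le hd hf (cfNum (partialQuot (shiftedF d)) k)
      (cfDen_partialQuot_ne_zero hG k)
    have h₃ := strictMono_natDegree_cfDen (one_le_natDegree_partialQuot hG) (Nat.lt_succ_self k)
    simp only [Nat.succ_eq_add_one] at h₃
    omega

/-- Every approximation of `x⁻¹ f_d(x)` of the best possible quality induces a convergent
of `g_d`. -/
theorem exists_convergent_g {p q : ℚ[X]} (hq : q ≠ 0) (hpq : IsCoprime p q)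
    (h : (ofPoly q * shiftedF d - ofPoly p).order = q.natDegree + 1) :
    ∃ (n : ℕ) (c : ℚ), c ≠ 0 ∧ cfNum (partialQuot (g d)) n = C c * ((X - 1) * expand ℚ d p) ∧
      cfDen (partialQuot (g d)) n = C c * expand ℚ d q ∧
      (cfDen (partialQuot (g d)) (n + 1)).natDegree = d * q.natDegree + (d - 1) := by
  have hq' : expand ℚ d q ≠ 0 := by rwa [Ne, expand_eq_zero (by omega)]
  have h1 : (expand ℚ d q).eval 1 ≠ 0 := by
    rw [expand_eval, one_pow]
    exact eval_one_ne_zero_of_lt_order hd hf (p := p) hq (by omega)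
  -- Coprimality survives the substitution, and the new factor `x - 1` does not divide `q(x ^ d)`
  -- because `q(1) ≠ 0`.
  have hc : IsCoprime ((X - 1) * expand ℚ d p) (expand ℚ d q) := by
    apply IsCoprime.mul_left
    · have := (irreducible_X_sub_C (1 : ℚ)).coprime_iff_not_dvd (n := expand ℚ d q)
      rw [map_one] at this
      rwa [this, ← map_one C, dvd_iff_isRoot]
    · exact hpq.map (expand ℚ d : ℚ[X] →+* ℚ[X])
  have ho := order_error_g_expand hd p hq
  rw [h] at ho
  obtain ⟨n, c, hc0, hn, hd', hdeg⟩ := exists_convergent_of_isCoprime (isIrrational_g hd) hq' hc (by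
    rw [ho, natDegree_expand]
    push_cast
    have : (2 : ℤ) ≤ d := by exact_mod_cast hd
    linarith)
  refine ⟨n, c, hc0, hn, hd', ?_⟩
  rw [ho] at hdeg
  zify [show 1 ≤ d by omega]
  rw [hdeg]
  ring

theorem natDegree_cfDen_g (k : ℕ) :
    (cfDen (partialQuot (g d)) (2 * k)).natDegree = d * k ∧
      (cfDen (partialQuot (g d)) (2 * k + 1)).natDegree = d * k + (d - 1) := by
  have hG := isIrrational_shiftedF hd
  have mono := strictMono_natDegree_cfDen (one_le_natDegree_partialQuot (isIrrational_g hd))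
  have key : ∀ k : ℕ, ∃ n, (cfDen (partialQuot (g d)) n).natDegree = d * k ∧
      (cfDen (partialQuot (g d)) (n + 1)).natDegree = d * k + (d - 1) := by
    intro k
    have hk := natDegree_cfDen_shiftedF hd hf
    obtain ⟨n, c, hc, -, h₁, h₂⟩ := exists_convergent_g hd hf (cfDen_partialQuot_ne_zero hG k)
      (isCoprime_cfNum_cfDen _ k) (by rw [order_error hG, hk, hk]; push_cast; ring)
    refine ⟨n, ?_, by rw [h₂, hk]⟩
    rw [h₁, natDegree_C_mul hc, natDegree_expand, hk, mul_comm]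
  have step : ∀ k, (cfDen (partialQuot (g d)) (2 * k)).natDegree = d * k →
      (cfDen (partialQuot (g d)) (2 * k + 1)).natDegree = d * k + (d - 1) := by
    intro k hk
    obtain ⟨n, h₁, h₂⟩ := key k
    have : n = 2 * k := mono.injective (h₁.trans hk.symm)
    rwa [this] at h₂
  suffices h : ∀ k, (cfDen (partialQuot (g d)) (2 * k)).natDegree = d * k from ⟨h k, step k (h k)⟩
  intro k
  induction k with
  | zero => simp [cfDen]
  | succ k ih =>
    have h₁ := step k ih
    obtain ⟨m, hm, -⟩ := key (k + 1)
    -- The degree `d (k + 1)` does occur, at some index `m`. It exceeds the degree at `2 k + 1` by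
    -- exactly 1, so strict monotonicity leaves room for no index in between.
    have h₂ : 2 * k + 1 < m := mono.lt_iff_lt.1 (by
      simp only [hm, h₁, mul_add]
      omega)
    have h₃ := mono (Nat.lt_succ_self (2 * k + 1))
    have h₄ := mono.le_iff_le.2 (show 2 * (k + 1) ≤ m by omega)
    simp only [Nat.succ_eq_add_one, h₁, hm, mul_add, mul_one, add_assoc, Nat.reduceAdd] at h₃ h₄ ⊢
    omega

theorem cfDen_g_even {p q : ℚ[X]} (hq : q ≠ 0) (hpq : IsCoprime p q)
    (h : (ofPoly q * shiftedF d - ofPoly p).order = q.natDegree + 1) :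
    ∃ c : ℚ, c ≠ 0 ∧
      cfNum (partialQuot (g d)) (2 * q.natDegree) = C c * ((X - 1) * expand ℚ d p) ∧
      cfDen (partialQuot (g d)) (2 * q.natDegree) = C c * expand ℚ d q := by
  obtain ⟨n, c, hc, h₁, h₂, -⟩ := exists_convergent_g hd hf hq hpq h
  have mono := strictMono_natDegree_cfDen (one_le_natDegree_partialQuot (isIrrational_g hd))
  have : n = 2 * q.natDegree := mono.injective (by
    rw [(natDegree_cfDen_g hd hf _).1, h₂, natDegree_C_mul hc, natDegree_expand, mul_comm])
  subst this
  exact ⟨c, hc, h₁, h₂⟩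

/-- The series `f_d` begins `1 - x⁻¹`, so `(1 + x⁻¹) f_d - 1` has order at least 2; the general
excess bound gives equality. Thus `1/(x + 1)` is the approximation of `G` that induces the second
convergent of `g_d`. -/
theorem order_error_X_add_one : (ofPoly (X + 1) * shiftedF d - ofPoly 1).order = 2 := by
  have hne : (X + 1 : ℚ[X]) ≠ 0 := by simpa using X_add_C_ne_zero (1 : ℚ)
  have hdeg : (X + 1 : ℚ[X]).natDegree = 1 := by simpa using natDegree_X_add_C (1 : ℚ)
  apply le_antisymm
  · have := order_error_shiftedF_le hd hf 1 hne
    rw [hdeg] at this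
    simpa using this
  · have e : ofPoly (X + 1) * shiftedF d - ofPoly 1 =
        HahnSeries.ofPowerSeries ℤ ℚ ((1 + PowerSeries.X) * fPow d - 1) := by
      simp only [map_sub, map_mul, map_add, map_one, ofPowerSeries_X_eq, ofPoly_X, shiftedF, f]
      rw [← mul_assoc, add_mul, mul_inv_cancel₀ x_ne_zero, one_mul]
    rw [HahnSeries.le_order_iff_forall (isIrrational_shiftedF hd _ _ hne), e]
    intro j hj
    rw [PowerSeries.coeff_coe]
    split_ifs with h
    · rfl
    · obtain rfl | rfl : j = 0 ∨ j = 1 := by omega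
      · simp [constantCoeff_fPow d hd]
      · rw [Int.natAbs_one, add_mul, one_mul, map_sub, map_add, coeff_one_fPow d hd,
          ← zero_add 1, PowerSeries.coeff_succ_X_mul]
        simp [constantCoeff_fPow d hd, PowerSeries.coeff_one]

/-! ### The monic denominators of `g_d` -/

theorem natDegree_convDenom_g (k : ℕ) :
    (convDenom (g d) (2 * k)).natDegree = d * k ∧
      (convDenom (g d) (2 * k + 1)).natDegree = d * k + (d - 1) := by
  have hg := isIrrational_g hd
  have h : ∀ n, (convDenom (g d) n).natDegree = (cfDen (partialQuot (g d)) n).natDegree := by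
    intro n
    rw [convDenom_eq hg, natDegree_C_mul]
    simpa using cfDen_partialQuot_ne_zero hg n
  rw [h, h]
  exact natDegree_cfDen_g hd hf k

theorem exists_convDenom_even_eq_expand (k : ℕ) :
    ∃ r : ℚ[X], convDenom (g d) (2 * k) = expand ℚ d r := by
  have hG := isIrrational_shiftedF hd
  have hk := natDegree_cfDen_shiftedF hd hf
  obtain ⟨c, -, -, h⟩ := cfDen_g_even hd hf (cfDen_partialQuot_ne_zero hG k)
    (isCoprime_cfNum_cfDen _ k) (by rw [order_error hG, hk, hk]; push_cast; ring)
  rw [hk] at h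
  rw [convDenom_eq (isIrrational_g hd), h]
  generalize (leadingCoeff (R := ℚ) _)⁻¹ = b
  exact ⟨C b * (C c * cfDen (partialQuot (shiftedF d)) k), by simp⟩

theorem eval_one_cfNum_g_even (k : ℕ) : (cfNum (partialQuot (g d)) (2 * k)).eval 1 = 0 := by
  have hG := isIrrational_shiftedF hd
  have hk := natDegree_cfDen_shiftedF hd hf
  obtain ⟨c, -, h, -⟩ := cfDen_g_even hd hf (cfDen_partialQuot_ne_zero hG k)
    (isCoprime_cfNum_cfDen _ k) (by rw [order_error hG, hk, hk]; push_cast; ring)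
  rw [hk] at h
  simp [h]

/-- At 1 the numerator recurrence reads `0 = a(1) P(1)` with `P` the odd numerator, and the
determinant identity excludes `P(1) = 0`. -/
theorem eval_one_partialQuot_g_even (k : ℕ) :
    (partialQuot (g d) (2 * k + 2)).eval 1 = 0 := by
  have h₀ := eval_one_cfNum_g_even hd hf k
  have h₁ := eval_one_cfNum_g_even hd hf (k + 1)
  have h₂ := congrArg (eval 1) (cfNum_add_two (partialQuot (g d)) (2 * k))
  have h₃ := congrArg (eval 1) (cfNum_mul_cfDen_sub (partialQuot (g d)) (2 * k))
  simp only [mul_add, mul_one, eval_add, eval_mul, eval_sub, eval_pow, eval_neg, eval_one, h₀,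
    zero_mul, sub_zero, add_zero] at h₁ h₂ h₃
  rw [h₁] at h₂
  rcases mul_eq_zero.1 h₂.symm with h | h
  · exact h
  · rw [h, zero_mul] at h₃
    exact absurd h₃.symm (pow_ne_zero _ (by norm_num))

end Approximation

/-- The three-term recurrence of the monic denominators. -/
theorem exists_convDenom_add_two {u : LaurentSeries ℚ} (hu : IsIrrational u) (n : ℕ) :
    ∃ (A : ℚ[X]) (β c : ℚ), A.Monic ∧ A = C c * partialQuot u (n + 2) ∧
      (convDenom u (n + 2)).natDegree = A.natDegree + (convDenom u (n + 1)).natDegree ∧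
      convDenom u (n + 2) = A * convDenom u (n + 1) + C β * convDenom u n := by
  have hne := cfDen_partialQuot_ne_zero hu
  have hmonic : ∀ n, (convDenom u n).Monic := fun n => RatFunc.monic_denom _
  set l : ℕ → ℚ := fun n => (cfDen (partialQuot u) n).leadingCoeff with hl
  have hl0 : ∀ n, l n ≠ 0 := fun n => by simpa [hl] using hne n
  have hM : ∀ n, cfDen (partialQuot u) n = C (l n) * convDenom u n := by
    intro n
    rw [convDenom_eq hu, ← mul_assoc, ← C_mul, mul_inv_cancel₀ (hl0 n), C_1, one_mul]
  have hrec : convDenom u (n + 2) = C ((l (n + 2))⁻¹ * l (n + 1)) * partialQuot u (n + 2) *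
      convDenom u (n + 1) + C ((l (n + 2))⁻¹ * l n) * convDenom u n := by
    have h := cfDen_add_two (partialQuot u) n
    rw [hM, hM (n + 1), hM n] at h
    apply mul_left_cancel₀ (C_ne_zero.2 (hl0 (n + 2)))
    rw [h, mul_add, ← mul_assoc, ← mul_assoc, ← mul_assoc, ← mul_assoc, ← C_mul, ← C_mul,
      mul_inv_cancel_left₀ (hl0 _), mul_inv_cancel_left₀ (hl0 _)]
    ring
  set A := C ((l (n + 2))⁻¹ * l (n + 1)) * partialQuot u (n + 2) with hA
  have hdeg : (convDenom u n).natDegree < (convDenom u (n + 2)).natDegree := by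
    have := strictMono_natDegree_cfDen (one_le_natDegree_partialQuot hu)
      (show n < n + 2 by omega)
    simp only at this
    rwa [hM n, hM (n + 2), natDegree_C_mul (hl0 _), natDegree_C_mul (hl0 _)] at this
  -- The older denominator has smaller degree, so the product inherits the leading coefficient 1.
  have hAM : (A * convDenom u (n + 1)).Monic := by
    have e : A * convDenom u (n + 1) =
        convDenom u (n + 2) - C ((l (n + 2))⁻¹ * l n) * convDenom u n := by rw [hrec]; ring
    rw [e]
    apply (hmonic _).sub_of_left
    apply degree_lt_degree
    exact (natDegree_C_mul_le _ _).trans_lt hdeg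
  have hAmonic : A.Monic := (hmonic _).of_mul_monic_right hAM
  refine ⟨A, _, _, hAmonic, hA, ?_, hrec⟩
  rw [← hAmonic.natDegree_mul (hmonic _), hrec]
  apply natDegree_add_eq_left_of_degree_lt
  apply degree_lt_degree
  refine (natDegree_C_mul_le _ _).trans_lt ?_
  by_contra! hle
  have h1 := natDegree_add_le (A * convDenom u (n + 1))
    (C ((l (n + 2))⁻¹ * l n) * convDenom u n)
  have h2 := natDegree_C_mul_le ((l (n + 2))⁻¹ * l n) (convDenom u n)
  rw [← hrec] at h1
  omega

/-- Division of `s` by `r` commutes with the substitution: the expanded remainder is a multiple of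
`r(x ^ d)` of smaller degree, hence zero, and `b` is the expanded quotient. -/
theorem exists_eq_expand_of_mul_expand {d : ℕ} (hd : 0 < d) {b r s : ℚ[X]} (hr : r.Monic)
    (h : b * expand ℚ d r = expand ℚ d s) : ∃ t, b = expand ℚ d t := by
  have hr' : (expand ℚ d r).Monic := hr.expand hd
  refine ⟨s /ₘ r, ?_⟩
  have e : expand ℚ d (s %ₘ r) = (b - expand ℚ d (s /ₘ r)) * expand ℚ d r := by
    have := congrArg (expand ℚ d) (modByMonic_add_div s r)
    rw [map_add, map_mul] at this
    linear_combination this - h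
  by_contra hne
  have hne' : b - expand ℚ d (s /ₘ r) ≠ 0 := sub_ne_zero.2 hne
  have hmod : s %ₘ r ≠ 0 := by
    intro h0
    rw [h0, map_zero] at e
    exact mul_ne_zero hne' hr'.ne_zero e.symm
  have h1 := congrArg natDegree e
  rw [natDegree_mul hne' hr'.ne_zero, natDegree_expand, natDegree_expand] at h1
  have h2 : (s %ₘ r).natDegree < r.natDegree := by
    apply natDegree_lt_natDegree hmod
    exact degree_modByMonic_lt s hr
  have := Nat.mul_lt_mul_of_pos_right h2 hd
  omega

/-- Comparing degrees makes `t` monic and linear, and the zero at 1 forces `t = x - 1`, so the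
product is `x ^ d - 1`. -/
theorem eq_geom_sum_of_mul_eq_expand {d : ℕ} (hd : 0 < d) {p t : ℚ[X]} (hp : p.Monic)
    (hdeg : p.natDegree = d - 1) (h : (X - 1) * p = expand ℚ d t) :
    p = ∑ i ∈ Finset.range d, X ^ i := by
  have hX : (X - 1 : ℚ[X]).Monic := by simpa using monic_X_sub_C (1 : ℚ)
  have hXd : (X - 1 : ℚ[X]).natDegree = 1 := by simpa using natDegree_X_sub_C (1 : ℚ)
  have ht : t.Monic := by
    have := hX.mul hp
    rwa [h, monic_expand_iff hd] at this
  have htd : t.natDegree = 1 := by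
    have := congrArg natDegree h
    rw [hX.natDegree_mul hp, hXd, hdeg, natDegree_expand] at this
    exact Nat.eq_of_mul_eq_mul_right hd (by omega)
  have ht1 : t.eval 1 = 0 := by
    have := congrArg (eval 1) h
    rw [expand_eval, one_pow] at this
    simpa using this.symm
  rw [ht.eq_X_add_C htd] at ht1 h
  have hc : t.coeff 0 = -1 := by
    simp at ht1
    linarith
  apply mul_left_cancel₀ hX.ne_zero
  rw [h, mul_geom_sum, hc]
  simp [sub_eq_add_neg]

theorem exists_convDenom_g_even_rec {d : ℕ} (hd : 2 ≤ d) (hf : BadlyApproximable (f d)) (k : ℕ) :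
    ∃ β : ℚ, convDenom (g d) (2 * k + 2) =
      (X - 1) * convDenom (g d) (2 * k + 1) + C β * convDenom (g d) (2 * k) := by
  obtain ⟨A, β, c, hA, hAc, hdeg, hrec⟩ := exists_convDenom_add_two (isIrrational_g hd) (2 * k)
  refine ⟨β, ?_⟩
  have h₁ := (natDegree_convDenom_g hd hf k).2
  have h₂ := (natDegree_convDenom_g hd hf (k + 1)).1
  rw [mul_add, mul_one, hdeg, h₁, mul_add] at h₂
  have hA1 : A.natDegree = 1 := by omega
  have hA0 : A.eval 1 = 0 := by
    rw [hAc, eval_mul, eval_one_partialQuot_g_even hd hf, mul_zero]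
  rw [hA.eq_X_add_C hA1] at hA0
  have hc : A.coeff 0 = -1 := by
    simp at hA0
    linarith
  rw [hrec, hA.eq_X_add_C hA1, hc]
  simp [sub_eq_add_neg]

theorem exists_convDenom_g_odd_rec {d : ℕ} (hd : 2 ≤ d) (hf : BadlyApproximable (f d)) (k : ℕ) :
    ∃ β : ℚ, convDenom (g d) (2 * k + 3) =
      (∑ i ∈ Finset.range d, X ^ i) * convDenom (g d) (2 * k + 2) +
        C β * convDenom (g d) (2 * k + 1) := by
  have hd0 : 0 < d := by omega
  obtain ⟨A, β, c, hA, -, hdeg, hrec⟩ := exists_convDenom_add_two (isIrrational_g hd) (2 * k + 1)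
  refine ⟨β, ?_⟩
  obtain ⟨b₀, hb₀⟩ := exists_convDenom_g_even_rec hd hf k
  obtain ⟨b₁, hb₁⟩ := exists_convDenom_g_even_rec hd hf (k + 1)
  obtain ⟨r₀, hr₀⟩ := exists_convDenom_even_eq_expand hd hf k
  obtain ⟨r₁, hr₁⟩ := exists_convDenom_even_eq_expand hd hf (k + 1)
  obtain ⟨r₂, hr₂⟩ := exists_convDenom_even_eq_expand hd hf (k + 2)
  have hd₁ := (natDegree_convDenom_g hd hf (k + 1)).1
  have hd₂ := (natDegree_convDenom_g hd hf (k + 1)).2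
  simp only [mul_add, mul_one, add_assoc, Nat.reduceAdd, Nat.reduceMul] at *
  have hmonic : r₁.Monic := by
    rw [← monic_expand_iff hd0, ← hr₁]
    exact RatFunc.monic_denom _
  -- The two even recurrences replace `x - 1` times each odd denominator by combinations of even
  -- ones, all of them polynomials in `x ^ d`.
  have e : (X - 1) * A * expand ℚ d r₁ =
      expand ℚ d (r₂ - C b₁ * r₁ - C β * (r₁ - C b₀ * r₀)) := by
    simp only [map_sub, map_mul, expand_C, ← hr₀, ← hr₁, ← hr₂]
    linear_combination (-1 : ℚ[X]) * (X - 1) * hrec - hb₁ + C β * hb₀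
  obtain ⟨t, ht⟩ := exists_eq_expand_of_mul_expand hd0 hmonic e
  rw [hrec, eq_geom_sum_of_mul_eq_expand hd0 hA (by omega) ht]

theorem convDenom_g_one {d : ℕ} (hd : 2 ≤ d) (hf : BadlyApproximable (f d)) :
    convDenom (g d) 1 = ∑ i ∈ Finset.range d, X ^ i := by
  have hd0 : 0 < d := by omega
  obtain ⟨b, hb⟩ := exists_convDenom_g_even_rec hd hf 0
  obtain ⟨r, hr⟩ := exists_convDenom_even_eq_expand hd hf 1
  have h0 : convDenom (g d) 0 = 1 := by simp [convDenom_eq (isIrrational_g hd), cfDen]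
  have hdeg := (natDegree_convDenom_g hd hf 0).2
  simp only [mul_zero, zero_add, mul_one, h0] at hb hr hdeg
  refine eq_geom_sum_of_mul_eq_expand (t := r - C b) hd0 (RatFunc.monic_denom _) hdeg ?_
  rw [map_sub, expand_C, ← hr, hb]
  ring

theorem convDenom_g_two {d : ℕ} (hd : 2 ≤ d) (hf : BadlyApproximable (f d)) :
    convDenom (g d) 2 = X ^ d + 1 := by
  have hmon : (X + 1 : ℚ[X]).Monic := by simpa using monic_X_add_C (1 : ℚ)
  have hdeg : (X + 1 : ℚ[X]).natDegree = 1 := by simpa using natDegree_X_add_C (1 : ℚ)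
  obtain ⟨c, hc, -, h⟩ := cfDen_g_even hd hf hmon.ne_zero isCoprime_one_left
    (by rw [order_error_X_add_one hd hf, hdeg]; rfl)
  rw [hdeg, mul_one] at h
  have hmon' : (expand ℚ d (X + 1 : ℚ[X])).Monic := hmon.expand (by omega)
  rw [convDenom_eq (isIrrational_g hd), h, leadingCoeff_mul, leadingCoeff_C, hmon'.leadingCoeff,
    mul_one, ← mul_assoc, ← C_mul, inv_mul_cancel₀ hc]
  simp

end GenThueMorse

open Polynomial in
theorem theorem2 (d : ℕ) (hd : 2 ≤ d)
    (hf : GenThueMorse.BadlyApproximable (GenThueMorse.f d)) :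
    GenThueMorse.convDenom (GenThueMorse.g d) 1 = ∑ i ∈ Finset.range d, (X : ℚ[X]) ^ i ∧
    GenThueMorse.convDenom (GenThueMorse.g d) 2 = (X : ℚ[X]) ^ d + 1 ∧
    ∃ β : ℕ → ℚ, ∀ k : ℕ, 1 ≤ k →
      GenThueMorse.convDenom (GenThueMorse.g d) (2 * k + 1) =
          (∑ i ∈ Finset.range d, (X : ℚ[X]) ^ i) * GenThueMorse.convDenom (GenThueMorse.g d) (2 * k)
            + C (β (2 * k + 1)) * GenThueMorse.convDenom (GenThueMorse.g d) (2 * k - 1) ∧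
      GenThueMorse.convDenom (GenThueMorse.g d) (2 * k + 2) =
          (X - 1) * GenThueMorse.convDenom (GenThueMorse.g d) (2 * k + 1)
            + C (β (2 * k + 2)) * GenThueMorse.convDenom (GenThueMorse.g d) (2 * k) := by
  refine ⟨GenThueMorse.convDenom_g_one hd hf, GenThueMorse.convDenom_g_two hd hf, ?_⟩
  choose b hb using GenThueMorse.exists_convDenom_g_odd_rec hd hf
  choose c hc using GenThueMorse.exists_convDenom_g_even_rec hd hf
  refine ⟨fun n => if Even n then c (n / 2 - 1) else b (n / 2 - 1), fun k hk => ?_⟩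
  obtain ⟨m, rfl⟩ := Nat.exists_eq_add_of_le' hk
  constructor
  · have h : ¬ Even (2 * (m + 1) + 1) := by simp
    have e : (2 * (m + 1) + 1) / 2 - 1 = m := by omega
    simp only [if_neg h, e]
    exact hb m
  · have h : Even (2 * (m + 1) + 2) := ⟨m + 2, by ring⟩
    have e : (2 * (m + 1) + 2) / 2 - 1 = m + 1 := by omega
    simp only [if_pos h, e]
    exact hc (m + 1)
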